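/- Let $\{A_k\}_{k=0}^\infty$ be a sequence of independent, identically distributed real random variables on a probability space, with $A_0\ge 1$ almost surely. For $n\in\mathbb N$ put $$P_n(z)=\sum_{k=0}^n A_k\,(z^k-1),$$ which for $n\ge 1$ is almost surely a polynomial of degree $n$, and let $\tau_n=\frac1n\sum_{j=1}^n\delta_{Z_j}$ be its normalized zero counting measure, where $Z_1,\dots,Z_n$ are the complex zeros of $P_n$ repeated according to multiplicity. Let $\mu_{\mathbb T}$ be the normalized arclength measure on the unit circle, $d\mu_{\mathbb T}(e^{it})=dt/(2\pi)$. Convergence of measures is weak convergence of finite measures on $\mathbb C$ (tested against bounded continuous functions). (i) If $\mathbb E[\log A_0]<\infty$, then almost surely $\tau_n\to\mu_{\mathbb T}$ weakly as $n\to\infty$. (ii) If $\mathbb E[\log A_0]=\infty$ and $A_0$ has a slowly varying tail, that is, $L(x)=\mathbb P(|A_0|>x)$ is positive and measurable for all large $x$ and $\lim_{x\to\infty}L(tx)/L(x)=1$ for every $t>0$, then there is a (random) subsequence along which the zero counting measures converge almost surely: there are $\mathbb N$-valued random variables $n_1,n_2,\dots$ on the same probability space such that, almost surely, $n_1<n_2<\cdots$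 and $\tau_{n_k}\to\mu_{\mathbb T}$ weakly as $k\to\infty$. -/

import Mathlib

open MeasureTheory ProbabilityTheory Filter Topology Polynomial
open scoped NNReal ENNReal

noncomputable section

/-- The random polynomial `P_n(z) = ∑_{k ≤ n} a_k (z^k - 1)`, for a given real coefficient
sequence `a`. -/
def shiftedPoly (a : ℕ → ℝ) (n : ℕ) : ℂ[X] :=
  ∑ k ∈ Finset.range (n + 1), C (a k : ℂ) * (X ^ k - 1)

/-- The normalized zero counting measure of a complex polynomial `p`: each zero, repeated according
to multiplicity, carries mass `1 / deg p`. (It is the zero measure if `p` is constant.) -/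
def zeroCountingMeasure (p : ℂ[X]) : FiniteMeasure ℂ :=
  (p.natDegree : ℝ≥0)⁻¹ • (p.roots.map fun z => (diracProba z).toFiniteMeasure).sum

/-- The measure `dt / (2π)` on `(0, 2π]`, pushed forward by `t ↦ exp (i t)`, as a measure on `ℂ`. -/
def circleArclength : Measure ℂ :=
  (ENNReal.ofReal (2 * Real.pi))⁻¹ •
    (volume.restrict (Set.Ioc 0 (2 * Real.pi))).map fun t : ℝ => Complex.exp (t * Complex.I)

instance circleArclength_isProbabilityMeasure : IsProbabilityMeasure circleArclength := by
  constructor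
  have h : Measurable fun t : ℝ => Complex.exp (t * Complex.I) := by fun_prop
  have hpi : 0 < 2 * Real.pi := Real.two_pi_pos
  simp only [circleArclength, Measure.smul_apply, smul_eq_mul, Measure.map_apply h .univ,
    Set.preimage_univ, Measure.restrict_apply_univ, Real.volume_Ioc, sub_zero]
  exact ENNReal.inv_mul_cancel (by simpa using hpi) ENNReal.ofReal_ne_top

/-- The normalized arclength measure of the unit circle. -/
def unitCircleMeasure : FiniteMeasure ℂ := ⟨circleArclength, inferInstance⟩

/-- `L` is slowly varying at infinity: it is positive and measurable on a neighbourhood of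
infinity, and `L (t x) / L x → 1` as `x → ∞`, for every `t > 0`. -/
def SlowlyVarying (L : ℝ → ℝ) : Prop :=
  (∃ x₀ : ℝ, (∀ x ≥ x₀, 0 < L x) ∧ Measurable fun x : Set.Ici x₀ => L x) ∧
    ∀ t : ℝ, 0 < t → Tendsto (fun x => L (t * x) / L x) atTop (𝓝 1)

/-- The random variable `X` has a slowly varying tail: `x ↦ ℙ(|X| > x)` is slowly varying. -/
def HasSlowlyVaryingTail {Ω : Type*} [MeasurableSpace Ω] (P : Measure Ω) (X : Ω → ℝ) : Prop :=
  SlowlyVarying fun x => P.real {ω | x < |X ω|}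

end

/-! Write `S = a 1 + ⋯ + a n`. All zeros lie outside the open unit disc, and their logarithmic
moduli add up to `log (S / a n)`; if this is `o(n)`, most zeros are close to the circle. For the
angles, the elementary symmetric functions of the inverse zeros are, up to sign, `1` and `a k / S`,
all at most one in modulus, so Newton's identities bound the `m`-th power sum by `2 ^ m`, uniformly
in `n`. Radial projection changes it by at most `m * log (S / a n)`, so Weyl's criterion gives
equidistribution. This is `tendsto_zeroCountingMeasure_shiftedPoly`.

What remains is growth. If `log A_0` is integrable, the strong law gives `log (A n) / n → 0`, which
suffices along all `n`. Otherwise the coefficients are almost surely unbounded, hence have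
infinitely many record indices, and there `S / a n ≤ n`. -/

/-! ### Power sums of inverse roots. -/

theorem Multiset.reverse_prod_X_sub_C {K : Type*} [Field K] (s : Multiset K) (hs : 0 ∉ s) :
    (s.map fun z => X - C z).prod.reverse =
      C (s.map Neg.neg).prod * ((s.map Inv.inv).map fun z => X - C z).prod := by
  induction s using Multiset.induction_on with
  | empty =>
    simpa using reverse_C (1 : K)
  | cons a s ih =>
    have ha : a ≠ 0 := fun h => hs (by simp [h])
    have key : (X - C a : K[X]).reverse = C (-a) * (X - C a⁻¹) := by
      have h1 : (X - C a : K[X]).reverse = 1 - C a * X := by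
        rw [reverse, natDegree_X_sub_C, sub_eq_add_neg, ← C_neg, reflect_add, reflect_C,
          reflect_one_X]
        simp [sub_eq_add_neg]
      rw [h1, mul_sub, ← C_mul, neg_mul, mul_inv_cancel₀ ha]
      simp
      ring
    simp only [Multiset.map_cons, Multiset.prod_cons, reverse_mul_of_domain, key]
    rw [ih fun h => hs (Multiset.mem_cons_of_mem h), C_mul]
    ring

theorem Multiset.esymm_eq_zero_of_card_lt {R : Type*} [CommSemiring R] {s : Multiset R} {k : ℕ}
    (h : Multiset.card s < k) : s.esymm k = 0 := by
  simp [Multiset.esymm, Multiset.powersetCard_eq_empty k h]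

/-- The elementary symmetric functions of the inverse roots of a polynomial are, up to sign, the
quotients of its coefficients by the constant coefficient. -/
theorem Polynomial.esymm_roots_inv {K : Type*} [Field K] {p : K[X]}
    (hsplit : p.Splits) (h0 : p.coeff 0 ≠ 0) (k : ℕ) :
    (p.roots.map Inv.inv).esymm k = (-1) ^ k * (p.coeff k / p.coeff 0) := by
  have hcard : Multiset.card p.roots = p.natDegree := splits_iff_card_roots.1 hsplit
  have h0' : (0 : K) ∉ p.roots := fun h => h0 (by
    simpa [coeff_zero_eq_eval_zero] using (mem_roots'.1 h).2)
  rcases lt_or_ge p.natDegree k with hk | hk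
  · rw [coeff_eq_zero_of_natDegree_lt hk, Multiset.esymm_eq_zero_of_card_lt (by simpa [hcard])]
    simp
  have hrev := congrArg reverse (C_leadingCoeff_mul_prod_multiset_X_sub_C hcard)
  rw [reverse_mul_of_domain, reverse_C, Multiset.reverse_prod_X_sub_C _ h0', ← mul_assoc,
    ← C_mul] at hrev
  have hq : ∀ j ≤ p.natDegree, p.coeff j = p.leadingCoeff * (p.roots.map Neg.neg).prod *
      ((-1) ^ j * (p.roots.map Inv.inv).esymm j) := by
    intro j hj
    have h1 := congrArg (fun q : K[X] => q.coeff (p.natDegree - j)) hrev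
    simp only [coeff_C_mul, coeff_reverse, revAt_le (Nat.sub_le _ _), Nat.sub_sub_self hj] at h1
    rw [← h1, Multiset.prod_X_sub_C_coeff _ (by simp [hcard])]
    simp [hcard, Nat.sub_sub_self hj]
  -- The case `j = 0` identifies the common factor in `hq` as `p.coeff 0`.
  have hc0 := hq 0 (Nat.zero_le _)
  simp only [pow_zero, Multiset.esymm, Multiset.powersetCard_zero_left,
    Multiset.map_singleton, Multiset.prod_zero, Multiset.sum_singleton, mul_one] at hc0
  rw [← hc0] at hq
  rw [hq k hk, mul_div_cancel_left₀ _ h0, ← mul_assoc, ← mul_pow]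
  simp

/-- Newton's identities for the power sums of a multiset. -/
theorem Multiset.sum_pow_eq_mul_esymm_sub_sum {R : Type*} [CommRing R] (s : Multiset R) {k : ℕ}
    (hk : 0 < k) :
    (s.map (· ^ k)).sum = (-1) ^ (k + 1) * k * s.esymm k -
      ∑ a ∈ Finset.HasAntidiagonal.antidiagonal k with a.1 ∈ Set.Ioo 0 k,
        (-1) ^ a.1 * s.esymm a.1 * (s.map (· ^ a.2)).sum := by
  obtain ⟨n, f, rfl⟩ : ∃ (n : ℕ) (f : Fin n → R), s = Finset.univ.val.map f := by
    induction s using Quot.inductionOn with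
    | h l => exact ⟨l.length, l.get, by simp [Fin.univ_val_map]⟩
  have h := congrArg (MvPolynomial.aeval f) (MvPolynomial.psum_eq_mul_esymm_sub_sum (Fin n) R k hk)
  simp only [map_sub, map_mul, map_sum, map_pow, map_neg, map_one, map_natCast,
    MvPolynomial.aeval_esymm_eq_multiset_esymm, MvPolynomial.psum, MvPolynomial.aeval_X] at h
  simp only [Multiset.map_map, Function.comp_def]
  exact h

/-- If the elementary symmetric functions are bounded by one, the power sums are bounded
independently of the number of variables. -/
theorem Multiset.norm_sum_pow_le_two_pow {s : Multiset ℂ} (hs : ∀ k, ‖s.esymm k‖ ≤ 1) {m : ℕ}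
    (hm : 0 < m) : ‖(s.map (· ^ m)).sum‖ ≤ 2 ^ m - 1 := by
  induction m using Nat.strong_induction_on with
  | _ m ih =>
    rw [Multiset.sum_pow_eq_mul_esymm_sub_sum s hm]
    -- The bound `2 ^ m - 1` is the solution of `c m = m + ∑ c j` over `1 ≤ j < m`, the recursion
    -- read off from Newton's identity.
    have h1 : ‖(-1 : ℂ) ^ (m + 1) * m * s.esymm m‖ ≤ m := by
      simpa using mul_le_mul_of_nonneg_left (hs m) (Nat.cast_nonneg (α := ℝ) m)
    have h2 : ‖∑ a ∈ Finset.HasAntidiagonal.antidiagonal m with a.1 ∈ Set.Ioo 0 m,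
        (-1) ^ a.1 * s.esymm a.1 * (s.map (· ^ a.2)).sum‖ ≤
        ∑ j ∈ Finset.Ico 1 m, ((2 : ℝ) ^ j - 1) := by
      refine (norm_sum_le _ _).trans ?_
      have h3 : ∀ a ∈ (Finset.HasAntidiagonal.antidiagonal m).filter (fun a => a.1 ∈ Set.Ioo 0 m),
          ‖(-1) ^ a.1 * s.esymm a.1 * (s.map (· ^ a.2)).sum‖ ≤ (2 : ℝ) ^ a.2 - 1 := by
        rintro ⟨i, j⟩ ha
        simp only [Finset.mem_filter, Finset.HasAntidiagonal.mem_antidiagonal, Set.mem_Ioo] at ha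
        have hj := ih j (by omega) (by omega)
        simp only [norm_mul, norm_pow, norm_neg, norm_one, one_pow, one_mul]
        simpa using mul_le_mul (hs i) hj (norm_nonneg _) zero_le_one
      refine (Finset.sum_le_sum h3).trans (le_of_eq ?_)
      refine Finset.sum_bij (fun a _ => a.2) ?_ ?_ ?_ (fun _ _ => rfl)
      · rintro ⟨i, j⟩ ha
        simp only [Finset.mem_filter, Finset.HasAntidiagonal.mem_antidiagonal, Set.mem_Ioo] at ha
        simp only [Finset.mem_Ico]
        omega
      · rintro ⟨i, j⟩ ha ⟨i', j'⟩ ha' h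
        simp only [Finset.mem_filter, Finset.HasAntidiagonal.mem_antidiagonal, Set.mem_Ioo] at ha ha'
        simp only at h
        ext <;> simp only <;> omega
      · intro j hj
        simp only [Finset.mem_Ico] at hj
        refine ⟨(m - j, j), ?_, rfl⟩
        simp only [Finset.mem_filter, Finset.HasAntidiagonal.mem_antidiagonal, Set.mem_Ioo]
        omega
    have h3 : ∀ n : ℕ, 0 < n → ∑ j ∈ Finset.Ico 1 n, ((2 : ℝ) ^ j - 1) = 2 ^ n - 1 - n := by
      intro n hn
      induction n, hn using Nat.le_induction with
      | base => norm_num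
      | succ n hn ih =>
        rw [Finset.sum_Ico_succ_top hn, ih]
        push_cast
        ring
    rw [h3 m hm] at h2
    calc _ ≤ _ := norm_sub_le _ _
      _ ≤ (m : ℝ) + (2 ^ m - 1 - m) := add_le_add h1 h2
      _ = 2 ^ m - 1 := by ring

/-! ### Coefficients and zeros of `shiftedPoly`. -/

theorem coeff_shiftedPoly_zero (a : ℕ → ℝ) (n : ℕ) :
    (shiftedPoly a n).coeff 0 = -((∑ k ∈ Finset.Icc 1 n, a k : ℝ) : ℂ) := by
  have hI : Finset.Ico 1 n.succ = Finset.Icc 1 n := by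
    ext k
    simp
  rw [coeff_zero_eq_eval_zero, shiftedPoly, eval_finsetSum, Finset.range_eq_Ico,
    Finset.sum_eq_sum_Ico_succ_bot n.succ_pos, zero_add, hI,
    Complex.ofReal_sum, ← Finset.sum_neg_distrib]
  simp only [pow_zero, sub_self, mul_zero, eval_zero, zero_add]
  refine Finset.sum_congr rfl fun k hk => ?_
  have hk' : k ≠ 0 := by
    rw [Finset.mem_Icc] at hk
    omega
  simp [hk']

theorem coeff_shiftedPoly_of_pos (a : ℕ → ℝ) (n : ℕ) {k : ℕ} (hk : 0 < k) :
    (shiftedPoly a n).coeff k = if k ≤ n then (a k : ℂ) else 0 := by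
  simp [shiftedPoly, finsetSum_coeff, coeff_C_mul, coeff_X_pow, coeff_one, hk.ne']

theorem natDegree_shiftedPoly {a : ℕ → ℝ} (ha : ∀ k, 1 ≤ a k) (n : ℕ) :
    (shiftedPoly a n).natDegree = n := by
  refine le_antisymm ?_ ?_
  · refine natDegree_le_iff_coeff_eq_zero.2 fun k hk => ?_
    rw [coeff_shiftedPoly_of_pos a n (by omega), if_neg (by omega)]
  · rcases n.eq_zero_or_pos with rfl | hn
    · simp
    · refine le_natDegree_of_ne_zero ?_
      rw [coeff_shiftedPoly_of_pos a n hn, if_pos le_rfl]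
      exact_mod_cast (zero_lt_one.trans_le (ha n)).ne'

theorem card_roots_shiftedPoly {a : ℕ → ℝ} (ha : ∀ k, 1 ≤ a k) (n : ℕ) :
    Multiset.card (shiftedPoly a n).roots = n := by
  rw [splits_iff_card_roots.1 (IsAlgClosed.splits _), natDegree_shiftedPoly ha]

theorem le_sum_Icc_of_one_le {a : ℕ → ℝ} (ha : ∀ k, 1 ≤ a k) {n k : ℕ} (hk : k ∈ Finset.Icc 1 n) :
    a k ≤ ∑ j ∈ Finset.Icc 1 n, a j :=
  Finset.single_le_sum (f := a) (fun j _ => zero_le_one.trans (ha j)) hk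

/-- If `‖z‖ < 1`, every term `a k * (z ^ k - 1)` has nonpositive real part, and the term `k = 1` has
a strictly negative one, so the sum cannot vanish. -/
theorem one_le_norm_of_mem_roots_shiftedPoly {a : ℕ → ℝ} (ha : ∀ k, 1 ≤ a k) {n : ℕ} {z : ℂ}
    (hz : z ∈ (shiftedPoly a n).roots) : 1 ≤ ‖z‖ := by
  by_contra! hlt
  have hn : 0 < n := by
    have h := Multiset.card_pos_iff_exists_mem.2 ⟨z, hz⟩
    rwa [card_roots_shiftedPoly ha] at h
  have h := congrArg Complex.re (mem_roots'.1 hz).2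
  simp only [shiftedPoly, eval_finsetSum, eval_mul, eval_C, eval_sub, eval_pow, eval_X, eval_one,
    Complex.re_sum, Complex.re_ofReal_mul, Complex.sub_re, Complex.one_re, Complex.zero_re] at h
  have hle : ∀ k, (z ^ k).re ≤ ‖z‖ ^ k := fun k => by
    simpa using Complex.re_le_norm (z ^ k)
  refine h.not_lt (Finset.sum_neg' (fun k _ => ?_) ⟨1, by simpa using hn, ?_⟩)
  · exact mul_nonpos_of_nonneg_of_nonpos (zero_le_one.trans (ha k))
      (sub_nonpos.2 ((hle k).trans (pow_le_one₀ (norm_nonneg _) hlt.le)))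
  · refine mul_neg_of_pos_of_neg (zero_lt_one.trans_le (ha 1)) (sub_neg.2 ((hle 1).trans_lt ?_))
    simpa using hlt

theorem Polynomial.sum_log_norm_roots {p : ℂ[X]} (h0 : p.coeff 0 ≠ 0) :
    (p.roots.map fun z => Real.log ‖z‖).sum = Real.log (‖p.coeff 0‖ / ‖p.leadingCoeff‖) := by
  have hp : p ≠ 0 := fun h => h0 (by simp [h])
  have h0' : (0 : ℂ) ∉ p.roots := fun h => h0 (by
    simpa [coeff_zero_eq_eval_zero] using (mem_roots'.1 h).2)
  have h1 : ‖p.coeff 0‖ / ‖p.leadingCoeff‖ = (p.roots.map fun z => ‖z‖).prod := by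
    rw [(IsAlgClosed.splits p).coeff_zero_eq_leadingCoeff_mul_prod_roots, norm_mul, norm_mul,
      norm_pow, norm_neg, norm_one, one_pow, one_mul,
      mul_div_cancel_left₀ _ (norm_ne_zero_iff.2 (leadingCoeff_ne_zero.2 hp))]
    exact map_multiset_prod (normHom : ℂ →*₀ ℝ) p.roots
  rw [h1]
  generalize p.roots = s at h0'
  clear h1 h0 hp
  induction s using Multiset.induction_on with
  | empty => simp
  | cons z s ih =>
    have hs : (0 : ℂ) ∉ s := fun h => h0' (Multiset.mem_cons_of_mem h)
    have hz : z ≠ 0 := fun h => h0' (by simp [h])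
    rw [Multiset.map_cons, Multiset.sum_cons, Multiset.map_cons, Multiset.prod_cons, Real.log_mul
      (norm_ne_zero_iff.2 hz), ih hs]
    refine Multiset.prod_ne_zero fun h => ?_
    obtain ⟨w, hw, hw'⟩ := Multiset.mem_map.1 h
    exact hs (norm_eq_zero.1 hw' ▸ hw)

theorem sum_Icc_pos {a : ℕ → ℝ} (ha : ∀ k, 1 ≤ a k) {n : ℕ} (hn : 0 < n) :
    0 < ∑ k ∈ Finset.Icc 1 n, a k :=
  zero_lt_one.trans_le ((ha 1).trans (le_sum_Icc_of_one_le ha (Finset.mem_Icc.2 ⟨le_rfl, hn⟩)))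

/-- All summands are nonnegative, so this one quantity measures how far the zeros are from the
circle in total. -/
theorem sum_log_norm_roots_shiftedPoly {a : ℕ → ℝ} (ha : ∀ k, 1 ≤ a k) {n : ℕ} (hn : 0 < n) :
    ((shiftedPoly a n).roots.map fun z => Real.log ‖z‖).sum =
      Real.log ((∑ k ∈ Finset.Icc 1 n, a k) / a n) := by
  have hS := sum_Icc_pos ha hn
  rw [Polynomial.sum_log_norm_roots, leadingCoeff, natDegree_shiftedPoly ha,
    coeff_shiftedPoly_zero, coeff_shiftedPoly_of_pos a n hn, if_pos le_rfl, norm_neg,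
    Complex.norm_of_nonneg hS.le, Complex.norm_of_nonneg (zero_le_one.trans (ha n))]
  rw [coeff_shiftedPoly_zero]
  exact neg_ne_zero.2 (by exact_mod_cast hS.ne')

theorem norm_sum_roots_shiftedPoly_inv_pow_le {a : ℕ → ℝ} (ha : ∀ k, 1 ≤ a k) {n : ℕ} (hn : 0 < n)
    {m : ℕ} (hm : 0 < m) :
    ‖((shiftedPoly a n).roots.map fun z => z⁻¹ ^ m).sum‖ ≤ 2 ^ m := by
  have hS := sum_Icc_pos ha hn
  have h0 : (shiftedPoly a n).coeff 0 ≠ 0 := by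
    rw [coeff_shiftedPoly_zero]
    exact neg_ne_zero.2 (by exact_mod_cast hS.ne')
  have h := Multiset.norm_sum_pow_le_two_pow (s := (shiftedPoly a n).roots.map Inv.inv)
    (fun k => ?_) hm
  · rw [Multiset.map_map] at h
    exact h.trans (by linarith)
  · rw [esymm_roots_inv (IsAlgClosed.splits _) h0, norm_mul, norm_pow, norm_neg, norm_one, one_pow,
      one_mul, norm_div]
    refine div_le_one_of_le₀ ?_ (norm_nonneg _)
    rcases k.eq_zero_or_pos with rfl | hk
    · exact le_rfl
    · rw [coeff_shiftedPoly_of_pos a n hk, coeff_shiftedPoly_zero, norm_neg,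
        Complex.norm_of_nonneg hS.le]
      split_ifs with hkn
      · rw [Complex.norm_of_nonneg (zero_le_one.trans (ha k))]
        exact le_sum_Icc_of_one_le ha (Finset.mem_Icc.2 ⟨hk, hkn⟩)
      · simpa using hS.le

/-! ### Radial projection of the zeros. -/

/-- The inverse powers of a complex number outside the open unit disc are close to those of its
radial projection. -/
theorem norm_inv_pow_sub_radial_le {z : ℂ} (hz : 1 ≤ ‖z‖) (m : ℕ) :
    ‖(z / ‖z‖)⁻¹ ^ m - z⁻¹ ^ m‖ ≤ m * Real.log ‖z‖ := by
  have hpos : 0 < ‖z‖ := zero_lt_one.trans_le hz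
  -- The first factor is unimodular; the second is handled by `1 - x⁻¹ ≤ log x`.
  have h1 : (z / ‖z‖)⁻¹ ^ m - z⁻¹ ^ m = (z / ‖z‖)⁻¹ ^ m * ((1 - (‖z‖ ^ m)⁻¹ : ℝ) : ℂ) := by
    have hz0 : z ≠ 0 := norm_pos_iff.1 hpos
    have hz1 : (‖z‖ : ℂ) ≠ 0 := by exact_mod_cast hpos.ne'
    push_cast
    rw [inv_div, div_pow, inv_pow]
    field_simp
  have h2 : (‖z‖ ^ m)⁻¹ ≤ 1 := inv_le_one_of_one_le₀ (one_le_pow₀ hz)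
  rw [h1, norm_mul, norm_pow, norm_inv, norm_div, Complex.norm_real, norm_norm,
    div_self hpos.ne', inv_one, one_pow, one_mul, Complex.norm_of_nonneg (sub_nonneg.2 h2)]
  have h3 := Real.one_sub_inv_le_log_of_pos (pow_pos hpos m)
  rwa [Real.log_pow] at h3

theorem Multiset.norm_sum_map_le {α E : Type*} [SeminormedAddCommGroup E] (s : Multiset α)
    {f : α → E} {g : α → ℝ} (h : ∀ x ∈ s, ‖f x‖ ≤ g x) : ‖(s.map f).sum‖ ≤ (s.map g).sum := by
  induction s using Multiset.induction_on with
  | empty => simp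
  | cons x s ih =>
    simp only [Multiset.map_cons, Multiset.sum_cons]
    exact norm_add_le_of_le (h x (Multiset.mem_cons_self x s))
      (ih fun y hy => h y (Multiset.mem_cons_of_mem hy))

theorem norm_sum_radial_roots_shiftedPoly_inv_pow_le {a : ℕ → ℝ} (ha : ∀ k, 1 ≤ a k) {n : ℕ}
    (hn : 0 < n) {m : ℕ} (hm : 0 < m) :
    ‖((shiftedPoly a n).roots.map fun z => (z / (‖z‖ : ℂ))⁻¹ ^ m).sum‖ ≤
      2 ^ m + m * Real.log ((∑ k ∈ Finset.Icc 1 n, a k) / a n) := by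
  have h1 := Multiset.norm_sum_map_le (shiftedPoly a n).roots
    fun z hz => norm_inv_pow_sub_radial_le (one_le_norm_of_mem_roots_shiftedPoly ha hz) m
  rw [Multiset.sum_map_mul_left, sum_log_norm_roots_shiftedPoly ha hn, Multiset.sum_map_sub] at h1
  have h2 := norm_sum_roots_shiftedPoly_inv_pow_le ha hn hm
  have h3 := norm_le_norm_add_norm_sub'
    ((shiftedPoly a n).roots.map fun z => (z / (‖z‖ : ℂ))⁻¹ ^ m).sum
    ((shiftedPoly a n).roots.map fun z => z⁻¹ ^ m).sum
  linarith

/-! ### Averages over multisets and Weyl's criterion. -/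

/-- The average of a function over a finite multiset. -/
noncomputable def Multiset.average {α : Type*} (s : Multiset α) (f : α → ℂ) : ℂ :=
  (Multiset.card s : ℂ)⁻¹ * (s.map f).sum

theorem Multiset.norm_average_le {α : Type*} (s : Multiset α) {f : α → ℂ} {g : α → ℝ}
    (h : ∀ x ∈ s, ‖f x‖ ≤ g x) :
    ‖s.average f‖ ≤ (Multiset.card s : ℝ)⁻¹ * (s.map g).sum := by
  rw [Multiset.average, norm_mul, norm_inv, Complex.norm_natCast]
  exact mul_le_mul_of_nonneg_left (Multiset.norm_sum_map_le s h) (by positivity)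

theorem Multiset.average_add {α : Type*} (s : Multiset α) (f g : α → ℂ) :
    s.average (fun x => f x + g x) = s.average f + s.average g := by
  rw [Multiset.average, Multiset.sum_map_add, mul_add]
  rfl

theorem Multiset.average_sub {α : Type*} (s : Multiset α) (f g : α → ℂ) :
    s.average (fun x => f x - g x) = s.average f - s.average g := by
  rw [Multiset.average, Multiset.sum_map_sub, mul_sub]
  rfl

theorem Multiset.average_const_mul {α : Type*} (s : Multiset α) (c : ℂ) (f : α → ℂ) :
    s.average (fun x => c * f x) = c * s.average f := by
  rw [Multiset.average, Multiset.sum_map_mul_left, mul_left_comm]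
  rfl

theorem Multiset.norm_average_le_of_forall_le {α : Type*} (s : Multiset α) {f : α → ℂ} {c : ℝ}
    (hc : 0 ≤ c) (h : ∀ x ∈ s, ‖f x‖ ≤ c) : ‖s.average f‖ ≤ c := by
  refine (s.norm_average_le h).trans ?_
  rw [Multiset.map_const', Multiset.sum_replicate, nsmul_eq_mul, ← mul_assoc]
  exact mul_le_of_le_one_left hc (inv_mul_le_one)

/-- Translation by `T / (2 * n)` preserves Haar measure and changes the sign of the character. -/
theorem integral_fourier_haarAddCircle {T : ℝ} [hT : Fact (0 < T)] {n : ℤ} (hn : n ≠ 0) :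
    ∫ t, fourier n t ∂(AddCircle.haarAddCircle (T := T)) = 0 := by
  have h := integral_add_right_eq_self (μ := AddCircle.haarAddCircle (T := T))
    (fun t => fourier n t) ((T / 2 / n : ℝ) : AddCircle T)
  simp only [fourier_add_half_inv_index hn hT.out, integral_neg] at h
  exact self_eq_neg.1 h.symm

/-- **Weyl's criterion** on the circle, for finite multisets of points. -/
theorem tendsto_average_of_tendsto_average_fourier {T : ℝ} [hT : Fact (0 < T)] {ι : Type*}
    {l : Filter ι} {s : ι → Multiset (AddCircle T)} (hcard : ∀ᶠ i in l, s i ≠ 0)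
    (h : ∀ n : ℤ, n ≠ 0 → Tendsto (fun i => (s i).average (fourier n)) l (𝓝 0))
    (F : C(AddCircle T, ℂ)) :
    Tendsto (fun i => (s i).average F) l (𝓝 (∫ t, F t ∂AddCircle.haarAddCircle)) := by
  have hint : ∀ G : C(AddCircle T, ℂ), Integrable G AddCircle.haarAddCircle := fun G =>
    G.continuous.integrable_of_hasCompactSupport (HasCompactSupport.of_compactSpace G)
  have hspan : ∀ G ∈ Submodule.span ℂ (Set.range (@fourier T)),
      Tendsto (fun i => (s i).average G) l (𝓝 (∫ t, G t ∂AddCircle.haarAddCircle)) := by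
    intro G hG
    induction hG using Submodule.span_induction with
    | mem G hG =>
      obtain ⟨n, rfl⟩ := hG
      rcases eq_or_ne n 0 with rfl | hn
      -- The average of `1` is `1` only on a nonempty multiset; on the empty one it is `0`.
      · refine tendsto_const_nhds.congr' (hcard.mono fun i hi => ?_)
        have hi' : (Multiset.card (s i) : ℂ) ≠ 0 := by simpa using hi
        have h1 : (fourier 0 : AddCircle T → ℂ) = fun _ => 1 := funext fun _ => fourier_zero
        simp [Multiset.average, h1, hi']
      · rw [integral_fourier_haarAddCircle hn]
        exact h n hn
    | zero =>
      simp only [ContinuousMap.coe_zero, Pi.zero_apply, integral_zero]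
      refine tendsto_const_nhds.congr fun i => ?_
      simp [Multiset.average]
    | add G₁ G₂ _ _ h₁ h₂ =>
      simp only [ContinuousMap.add_apply, integral_add (hint G₁) (hint G₂)]
      exact (h₁.add h₂).congr fun i => (Multiset.average_add _ _ _).symm
    | smul c G _ h₁ =>
      simp only [ContinuousMap.smul_apply, smul_eq_mul, integral_const_mul]
      exact (h₁.const_mul c).congr fun i => (Multiset.average_const_mul _ _ _).symm
  rw [Metric.tendsto_nhds]
  intro ε hε
  -- Trigonometric polynomials are uniformly dense, and both the averages and the integral are
  -- contractions for the sup norm.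
  obtain ⟨G, hG, hFG⟩ : ∃ G ∈ Submodule.span ℂ (Set.range (@fourier T)), ‖F - G‖ < ε / 3 := by
    have hF : F ∈ (Submodule.span ℂ (Set.range (@fourier T))).topologicalClosure := by
      rw [span_fourier_closure_eq_top]
      trivial
    obtain ⟨G, hG, hd⟩ := Metric.mem_closure_iff.1 hF (ε / 3) (by positivity)
    exact ⟨G, hG, by rwa [← dist_eq_norm]⟩
  have hpt : ∀ t, ‖F t - G t‖ ≤ ‖F - G‖ := fun t => (F - G).norm_coe_le_norm t
  filter_upwards [Metric.tendsto_nhds.1 (hspan G hG) (ε / 3) (by positivity)] with i hi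
  have h1 : ‖(s i).average F - (s i).average G‖ ≤ ‖F - G‖ := by
    rw [← Multiset.average_sub]
    exact (s i).norm_average_le_of_forall_le (norm_nonneg _) fun t _ => hpt t
  have h2 : ‖∫ t, G t ∂AddCircle.haarAddCircle - ∫ t, F t ∂AddCircle.haarAddCircle‖ ≤
      ‖F - G‖ := by
    rw [← integral_sub (hint G) (hint F)]
    refine (norm_integral_le_of_norm_le_const (ae_of_all _ fun t => ?_)).trans_eq
      (b := ‖F - G‖ * (AddCircle.haarAddCircle (T := T)).real Set.univ) (by simp)
    rw [norm_sub_rev]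
    exact hpt t
  rw [dist_eq_norm] at hi ⊢
  calc _ = ‖((s i).average F - (s i).average G) +
        ((s i).average G - ∫ t, G t ∂AddCircle.haarAddCircle) +
        (∫ t, G t ∂AddCircle.haarAddCircle - ∫ t, F t ∂AddCircle.haarAddCircle)‖ := by
        congr 1
        ring
    _ ≤ _ := norm_add₃_le
    _ < ε := by linarith

/-! ### From the circle to measures on the plane. -/

theorem integral_circleArclength [Fact (0 < 2 * Real.pi)] {f : ℂ → ℂ} (hf : Continuous f) :
    ∫ z, f z ∂circleArclength =
      ∫ t : AddCircle (2 * Real.pi), f (AddCircle.toCircle t) ∂AddCircle.haarAddCircle := by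
  have hm : Measurable fun t : ℝ => Complex.exp (t * Complex.I) := by fun_prop
  rw [AddCircle.integral_haarAddCircle, ← AddCircle.integral_preimage (2 * Real.pi) 0,
    circleArclength, integral_smul_measure, integral_map hm.aemeasurable
      hf.aestronglyMeasurable, ENNReal.toReal_inv,
    ENNReal.toReal_ofReal Real.two_pi_pos.le, zero_add]
  congr 1
  refine integral_congr_ae (ae_of_all _ fun t => ?_)
  simp only [AddCircle.toCircle_apply_mk, Circle.coe_exp]
  congr 3
  push_cast
  have : (Real.pi : ℂ) ≠ 0 := by exact_mod_cast Real.pi_ne_zero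
  field_simp

theorem integral_zeroCountingMeasure (p : ℂ[X]) (hp : Multiset.card p.roots = p.natDegree)
    (f : BoundedContinuousFunction ℂ ℂ) :
    ∫ z, f z ∂(zeroCountingMeasure p : Measure ℂ) = p.roots.average f := by
  have h : ∀ s : Multiset ℂ,
      ∫ z, f z ∂(((s.map fun z => (diracProba z).toFiniteMeasure).sum : FiniteMeasure ℂ) :
        Measure ℂ) = (s.map f).sum := by
    intro s
    induction s using Multiset.induction_on with
    | empty => simp
    | cons a s ih =>
      rw [Multiset.map_cons, Multiset.sum_cons, FiniteMeasure.toMeasure_add,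
        integral_add_measure (f.integrable _) (f.integrable _), ih, Multiset.map_cons,
        Multiset.sum_cons]
      congr 1
      exact integral_dirac _ _
  rw [zeroCountingMeasure, FiniteMeasure.toMeasure_smul, integral_smul_nnreal_measure, h,
    Multiset.average, hp, NNReal.smul_def]
  simp

/-- Near the circle, uniform continuity on the disc of radius 2 gives `ε`. Farther out, `log ‖z‖` is
bounded below, so a large `K` absorbs the trivial bound `2 * B`. -/
theorem exists_norm_sub_radial_le {f : ℂ → ℂ} (hf : Continuous f) {B : ℝ} (hB : ∀ z, ‖f z‖ ≤ B)
    {ε : ℝ} (hε : 0 < ε) :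
    ∃ K : ℝ, ∀ z : ℂ, 1 ≤ ‖z‖ → ‖f z - f (z / ‖z‖)‖ ≤ ε + K * Real.log ‖z‖ := by
  have hB0 : 0 ≤ B := (norm_nonneg _).trans (hB 0)
  obtain ⟨δ, hδ, h⟩ := Metric.uniformContinuousOn_iff.1
    ((isCompact_closedBall (0 : ℂ) 2).uniformContinuousOn_of_continuous hf.continuousOn) ε hε
  set η := min δ 1 with hη
  have hη0 : 0 < η := lt_min hδ one_pos
  have hlog : 0 < Real.log (1 + η) := Real.log_pos (by linarith)
  refine ⟨2 * B / Real.log (1 + η), fun z hz => ?_⟩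
  have hpos : 0 < ‖z‖ := zero_lt_one.trans_le hz
  rcases lt_or_ge ‖z‖ (1 + η) with hlt | hge
  · have hu : ‖z / (‖z‖ : ℂ)‖ = 1 := by
      rw [norm_div, Complex.norm_real, norm_norm, div_self hpos.ne']
    have hd : dist z (z / ‖z‖) < δ := by
      have h1 : z - z / ‖z‖ = (z / ‖z‖) * ((‖z‖ - 1 : ℝ) : ℂ) := by
        have : (‖z‖ : ℂ) ≠ 0 := by exact_mod_cast hpos.ne'
        push_cast
        field_simp
      rw [dist_eq_norm, h1, norm_mul, hu, one_mul, Complex.norm_of_nonneg (by linarith)]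
      linarith [min_le_left δ 1]
    have h2 := h z (by simpa using by linarith [min_le_right δ 1]) (z / ‖z‖)
      (by simp only [Metric.mem_closedBall, dist_zero_right, hu]; norm_num) hd
    rw [dist_eq_norm] at h2
    have : 0 ≤ 2 * B / Real.log (1 + η) * Real.log ‖z‖ :=
      mul_nonneg (by positivity) (Real.log_nonneg hz)
    linarith
  · have h1 : 2 * B ≤ 2 * B / Real.log (1 + η) * Real.log ‖z‖ := by
      rw [div_mul_eq_mul_div, le_div_iff₀ hlog]
      exact mul_le_mul_of_nonneg_left (Real.log_le_log (by linarith) hge) (by positivity)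
    have h2 := norm_sub_le (f z) (f (z / ‖z‖))
    linarith [hB z, hB (z / ‖z‖)]

theorem toCircle_arg (z : ℂ) (hz : z ≠ 0) :
    ((AddCircle.toCircle ((Complex.arg z : ℝ) : AddCircle (2 * Real.pi)) : Circle) : ℂ) =
      z / ‖z‖ := by
  have hz1 : (‖z‖ : ℂ) ≠ 0 := by exact_mod_cast norm_ne_zero_iff.2 hz
  rw [AddCircle.toCircle_apply_mk, div_self Real.two_pi_pos.ne', one_mul, Circle.coe_exp,
    eq_div_iff hz1, mul_comm]
  exact Complex.norm_mul_exp_arg_mul_I z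

theorem norm_average_fourier_neg {T : ℝ} (s : Multiset (AddCircle T)) (n : ℤ) :
    ‖s.average (fourier (-n))‖ = ‖s.average (fourier n)‖ := by
  rw [Multiset.average, Multiset.average, norm_mul, norm_mul]
  congr 1
  have h : (s.map (fourier (-n))).sum = starRingEnd ℂ (s.map (fourier n)).sum := by
    rw [map_multiset_sum, Multiset.map_map]
    congr 1
    exact Multiset.map_congr rfl fun x _ => fourier_neg
  rw [h, RCLike.norm_conj]

/-- If `log ((a 1 + ⋯ + a n) / a n) = o(n)` along a sequence of indices, then the zeros of
`shiftedPoly a n` are equidistributed on the unit circle along this sequence. -/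
theorem tendsto_zeroCountingMeasure_shiftedPoly {ι : Type*} {l : Filter ι} {a : ℕ → ℝ}
    (ha : ∀ k, 1 ≤ a k) {N : ι → ℕ} (hN : Tendsto N l atTop)
    (h : Tendsto (fun i => Real.log ((∑ k ∈ Finset.Icc 1 (N i), a k) / a (N i)) / N i) l (𝓝 0)) :
    Tendsto (fun i => zeroCountingMeasure (shiftedPoly a (N i))) l (𝓝 unitCircleMeasure) := by
  have : Fact (0 < 2 * Real.pi) := ⟨Real.two_pi_pos⟩
  have hpos : ∀ᶠ i in l, 0 < N i := hN.eventually (eventually_gt_atTop 0)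
  have hinv : Tendsto (fun i => ((N i : ℝ))⁻¹) l (𝓝 0) :=
    tendsto_inv_atTop_zero.comp (tendsto_natCast_atTop_atTop.comp hN)
  have hcard := fun i => card_roots_shiftedPoly ha (N i)
  have hne : ∀ i, ∀ z ∈ (shiftedPoly a (N i)).roots, z ≠ 0 := fun i z hz =>
    norm_pos_iff.1 (zero_lt_one.trans_le (one_le_norm_of_mem_roots_shiftedPoly ha hz))
  rw [FiniteMeasure.tendsto_iff_forall_integral_rclike_tendsto ℂ]
  intro f
  have hint : ∀ i, ∫ z, f z ∂(zeroCountingMeasure (shiftedPoly a (N i)) : Measure ℂ) =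
      (shiftedPoly a (N i)).roots.average f := fun i =>
    integral_zeroCountingMeasure _ (splits_iff_card_roots.1 (IsAlgClosed.splits _)) f
  simp only [hint]
  let t : ι → Multiset (AddCircle (2 * Real.pi)) := fun i =>
    (shiftedPoly a (N i)).roots.map fun z => ((Complex.arg z : ℝ) : AddCircle (2 * Real.pi))
  have hfourier : ∀ m : ℕ, 0 < m → Tendsto (fun i => (t i).average (fourier (-m : ℤ))) l (𝓝 0) := by
    intro m hm
    have hlim : Tendsto (fun i => 2 ^ m * ((N i : ℝ))⁻¹ +
        m * (Real.log ((∑ k ∈ Finset.Icc 1 (N i), a k) / a (N i)) / N i)) l (𝓝 0) := by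
      simpa using (hinv.const_mul (2 ^ m)).add (h.const_mul (m : ℝ))
    refine squeeze_zero_norm' (hpos.mono fun i hi => ?_) hlim
    have h1 := norm_sum_radial_roots_shiftedPoly_inv_pow_le ha hi hm
    have h2 : ((t i).map (fourier (-m : ℤ))).sum =
        ((shiftedPoly a (N i)).roots.map fun z => (z / (‖z‖ : ℂ))⁻¹ ^ m).sum := by
      rw [Multiset.map_map]
      congr 1
      refine Multiset.map_congr rfl fun z hz => ?_
      rw [Function.comp_apply, fourier_apply, AddCircle.toCircle_zsmul, Circle.coe_zpow,
        toCircle_arg z (hne i z hz), zpow_neg, zpow_natCast, inv_pow]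
    rw [Multiset.average, h2, Multiset.card_map, hcard, norm_mul, norm_inv, Complex.norm_natCast]
    calc _ ≤ _ := mul_le_mul_of_nonneg_left h1 (by positivity)
      _ = _ := by ring
  let F : C(AddCircle (2 * Real.pi), ℂ) := ⟨fun x => f (AddCircle.toCircle x), by fun_prop⟩
  have hF := tendsto_average_of_tendsto_average_fourier (s := t) (l := l)
    (hpos.mono fun i hi => Multiset.card_pos.1 (by simpa [t, hcard] using hi)) (fun n hn => ?_) F
  · have hI : ∫ z, f z ∂(unitCircleMeasure : Measure ℂ) =
        ∫ x, F x ∂AddCircle.haarAddCircle := integral_circleArclength f.continuous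
    -- Moving the zeros radially onto the circle costs `ε / 2` plus a multiple of the mean of `log
    -- ‖z‖`, which tends to zero by `h`.
    have hdiff : Tendsto (fun i => (shiftedPoly a (N i)).roots.average f - (t i).average F) l
        (𝓝 0) := by
      rw [Metric.tendsto_nhds]
      intro ε hε
      obtain ⟨K, hK⟩ := exists_norm_sub_radial_le f.continuous f.norm_coe_le_norm (half_pos hε)
      have hlim : Tendsto (fun i => ε / 2 +
          K * (Real.log ((∑ k ∈ Finset.Icc 1 (N i), a k) / a (N i)) / N i)) l (𝓝 (ε / 2)) := by
        simpa using (h.const_mul K).const_add (ε / 2)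
      filter_upwards [hpos, hlim.eventually_lt_const (half_lt_self hε)] with i hi hlt
      have hN0 : (N i : ℝ) ≠ 0 := by exact_mod_cast hi.ne'
      have h1 : (t i).average F = (shiftedPoly a (N i)).roots.average fun z => f (z / ‖z‖) := by
        rw [Multiset.average, Multiset.average, Multiset.map_map, Multiset.card_map]
        congr 2
        refine Multiset.map_congr rfl fun z hz => ?_
        rw [← toCircle_arg z (hne i z hz)]
        rfl
      rw [h1, ← Multiset.average_sub, dist_zero_right]
      refine lt_of_le_of_lt (((shiftedPoly a (N i)).roots.norm_average_le fun z hz =>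
        hK z (one_le_norm_of_mem_roots_shiftedPoly ha hz)).trans_eq ?_) hlt
      rw [Multiset.sum_map_add, Multiset.sum_map_mul_left, sum_log_norm_roots_shiftedPoly ha hi,
        Multiset.map_const', Multiset.sum_replicate, hcard, nsmul_eq_mul]
      field_simp
    rw [hI]
    simpa using hdiff.add hF
  -- Inverse powers yield the negative frequencies; conjugation gives the positive ones.
  · rcases Int.lt_or_gt_of_ne hn with hn | hn
    · have h1 := hfourier n.natAbs (by omega)
      rwa [show (-(n.natAbs : ℤ)) = n by omega] at h1
    · have h1 := hfourier n.natAbs (by omega)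
      rw [show ((n.natAbs : ℤ)) = n by omega] at h1
      rw [tendsto_zero_iff_norm_tendsto_zero] at h1 ⊢
      simpa only [norm_average_fourier_neg] using h1

/-! ### Growth conditions on the coefficients and record indices. -/

theorem tendsto_log_sum_div_of_tendsto_log_div {a : ℕ → ℝ} (ha : ∀ k, 1 ≤ a k)
    (h : Tendsto (fun n : ℕ => Real.log (a n) / n) atTop (𝓝 0)) :
    Tendsto (fun n : ℕ => Real.log ((∑ k ∈ Finset.Icc 1 n, a k) / a n) / n) atTop (𝓝 0) := by
  have hapos : ∀ k, 0 < a k := fun k => zero_lt_one.trans_le (ha k)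
  have hlogn : Tendsto (fun n : ℕ => Real.log n / n) atTop (𝓝 0) :=
    Real.isLittleO_log_id_atTop.tendsto_div_nhds_zero.comp tendsto_natCast_atTop_atTop
  rw [Metric.tendsto_nhds]
  intro ε hε
  obtain ⟨K, hK⟩ := eventually_atTop.1 (h.eventually_lt_const (half_pos hε))
  -- As the logarithms are nonnegative, `c` dominates each of the finitely many exceptional ones.
  set c := ∑ k ∈ Finset.range K, Real.log (a k) with hc
  have hc0 : 0 ≤ c := Finset.sum_nonneg fun k _ => Real.log_nonneg (ha k)
  have hbound : ∀ n, ∀ k ∈ Finset.Icc 1 n, a k ≤ Real.exp (c + ε / 2 * n) := by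
    intro n k hk
    rw [Finset.mem_Icc] at hk
    have hkn : (k : ℝ) ≤ n := by exact_mod_cast hk.2
    rw [← Real.log_le_iff_le_exp (hapos k)]
    rcases lt_or_ge k K with hkK | hkK
    · have := Finset.single_le_sum (f := fun k => Real.log (a k))
        (fun j _ => Real.log_nonneg (ha j)) (Finset.mem_range.2 hkK)
      have h2 : 0 ≤ ε / 2 * n := by positivity
      linarith
    · have h1 := hK k hkK
      rw [div_lt_iff₀ (by exact_mod_cast hk.1)] at h1
      have h2 : ε / 2 * k ≤ ε / 2 * n := mul_le_mul_of_nonneg_left hkn (by positivity)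
      linarith
  have hlim : Tendsto (fun n : ℕ => Real.log n / n + c * (n : ℝ)⁻¹ + ε / 2) atTop (𝓝 (ε / 2)) := by
    simpa using ((hlogn.add (tendsto_inv_atTop_nhds_zero_nat.const_mul c)).add_const (ε / 2))
  filter_upwards [eventually_gt_atTop 0, hlim.eventually_lt_const (half_lt_self hε)] with n hn hlt
  have hn' : (0 : ℝ) < n := by exact_mod_cast hn
  have hS := sum_Icc_pos ha hn
  have h1 : a n ≤ ∑ k ∈ Finset.Icc 1 n, a k := le_sum_Icc_of_one_le ha (Finset.mem_Icc.2 ⟨hn, le_rfl⟩)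
  have h0 : 0 ≤ Real.log ((∑ k ∈ Finset.Icc 1 n, a k) / a n) :=
    Real.log_nonneg ((one_le_div (hapos n)).2 h1)
  have h2 : Real.log ((∑ k ∈ Finset.Icc 1 n, a k) / a n) ≤ Real.log n + (c + ε / 2 * n) := by
    have h3 : (∑ k ∈ Finset.Icc 1 n, a k) ≤ n * Real.exp (c + ε / 2 * n) := by
      simpa using Finset.sum_le_card_nsmul _ _ _ (hbound n)
    calc _ ≤ Real.log (n * Real.exp (c + ε / 2 * n)) :=
          Real.log_le_log (div_pos hS (hapos n)) ((div_le_self hS.le (ha n)).trans h3)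
      _ = _ := by rw [Real.log_mul hn'.ne' (Real.exp_ne_zero _), Real.log_exp]
  rw [dist_zero_right, Real.norm_of_nonneg (div_nonneg h0 hn'.le)]
  refine lt_of_le_of_lt ((div_le_div_of_nonneg_right h2 hn'.le).trans_eq ?_) hlt
  field_simp
  ring

theorem log_sum_div_le_of_forall_le {a : ℕ → ℝ} (ha : ∀ k, 1 ≤ a k) {n : ℕ} (hn : 0 < n)
    (h : ∀ k ≤ n, a k ≤ a n) :
    |Real.log ((∑ k ∈ Finset.Icc 1 n, a k) / a n)| ≤ Real.log n := by
  have han : 0 < a n := zero_lt_one.trans_le (ha n)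
  rw [abs_of_nonneg]
  · refine Real.log_le_log (div_pos (sum_Icc_pos ha hn) han) ((div_le_iff₀ han).2 ?_)
    simpa using Finset.sum_le_card_nsmul (Finset.Icc 1 n) a (a n) fun k hk =>
      h k (Finset.mem_Icc.1 hk).2
  · exact Real.log_nonneg ((one_le_div han).2
      (le_sum_Icc_of_one_le ha (Finset.mem_Icc.2 ⟨hn, le_rfl⟩)))

/-- An unbounded sequence attains its running maximum at arbitrarily large indices. -/
theorem exists_gt_forall_le_of_unbounded {a : ℕ → ℝ} (h : ∀ M : ℕ, ∃ n, (M : ℝ) < a n) (m : ℕ) :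
    ∃ n, m < n ∧ ∀ k ≤ n, a k ≤ a n := by
  classical
  -- No term up to index `m` exceeds `M`, so the first index whose term does is beyond `m`, and it
  -- is a record.
  obtain ⟨M, hM⟩ := exists_nat_ge (∑ k ∈ Finset.range (m + 1), |a k|)
  have hlt := Nat.find_spec (h M)
  have hmin : ∀ k < Nat.find (h M), a k ≤ M := fun k hk => not_lt.1 (Nat.find_min (h M) hk)
  refine ⟨Nat.find (h M), ?_, fun k hk => ?_⟩
  · by_contra! hle
    have h1 := Finset.single_le_sum (f := fun k => |a k|) (fun j _ => abs_nonneg (a j))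
      (Finset.mem_range.2 (Nat.lt_succ_of_le hle))
    have h2 := le_abs_self (a (Nat.find (h M)))
    linarith
  · rcases hk.lt_or_eq with hk | rfl
    · exact (hmin k hk).trans hlt.le
    · exact le_rfl

/-- Measurable selection of an increasing sequence of indices with a given property. -/
theorem exists_measurable_strictMono_nat {Ω : Type*} [MeasurableSpace Ω] {R : Ω → ℕ → Prop}
    (hR : ∀ n, MeasurableSet {ω | R ω n}) :
    ∃ N : ℕ → Ω → ℕ, (∀ j, Measurable (N j)) ∧ ∀ ω, (∀ m, ∃ n, m < n ∧ R ω n) →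
      StrictMono (fun j => N j ω) ∧ ∀ j, R ω (N (j + 1) ω) := by
  classical
  have hnext : ∀ M : {M : Ω → ℕ // Measurable M}, ∃ M' : {M : Ω → ℕ // Measurable M},
      ∀ ω, (∃ n, M.1 ω < n ∧ R ω n) → M.1 ω < M'.1 ω ∧ R ω (M'.1 ω) := by
    rintro ⟨M, hM⟩
    have hmeas : ∀ k, MeasurableSet {ω | M ω < k ∧ R ω k} := fun k =>
      (measurableSet_lt hM measurable_const).inter (hR k)
    -- The second alternative makes the search total: where no later index exists, it returns `0`.
    have hex : ∀ ω, ∃ n, (M ω < n ∧ R ω n) ∨ ∀ m, ¬(M ω < m ∧ R ω m) := fun ω => by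
      by_cases h : ∃ n, M ω < n ∧ R ω n
      · exact h.imp fun n hn => Or.inl hn
      · exact ⟨0, Or.inr (not_exists.1 h)⟩
    refine ⟨⟨fun ω => Nat.find (hex ω), measurable_find hex fun k => ?_⟩, fun ω hω => ?_⟩
    · refine (hmeas k).union ?_
      have : {ω | ∀ m, ¬(M ω < m ∧ R ω m)} = ⋂ m, {ω | M ω < m ∧ R ω m}ᶜ := by
        ext ω
        simp
      change MeasurableSet {ω | ∀ m, ¬(M ω < m ∧ R ω m)}
      exact this ▸ MeasurableSet.iInter fun m => (hmeas m).compl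
    · obtain ⟨n, hn⟩ := hω
      exact (Nat.find_spec (hex ω)).resolve_right fun h => h n hn
  choose next hnext using hnext
  let N : ℕ → {M : Ω → ℕ // Measurable M} := fun j =>
    Nat.rec ⟨fun _ => 0, measurable_const⟩ (fun _ M => next M) j
  refine ⟨fun j => (N j).1, fun j => (N j).2, fun ω hω => ?_⟩
  have hstep : ∀ j, (N j).1 ω < (N (j + 1)).1 ω ∧ R ω ((N (j + 1)).1 ω) := fun j =>
    hnext (N j) ω (hω _)
  exact ⟨strictMono_nat_of_lt_succ fun j => (hstep j).1, fun j => (hstep j).2⟩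

/-! ### Almost sure behaviour of the coefficients. -/

theorem ae_tendsto_log_div_of_lintegral_lt_top {Ω : Type*} [MeasurableSpace Ω] {P : Measure Ω}
    {A : ℕ → Ω → ℝ} (hmeas : ∀ k, Measurable (A k)) (hindep : iIndepFun A P)
    (hident : ∀ k, IdentDistrib (A k) (A 0) P P) (hone : ∀ᵐ ω ∂P, 1 ≤ A 0 ω)
    (h : ∫⁻ ω, ENNReal.ofReal (Real.log (A 0 ω)) ∂P < ∞) :
    ∀ᵐ ω ∂P, Tendsto (fun n : ℕ => Real.log (A n ω) / n) atTop (𝓝 0) := by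
  have hint : Integrable (fun ω => Real.log (A 0 ω)) P :=
    (lintegral_ofReal_ne_top_iff_integrable
      (Real.measurable_log.comp (hmeas 0)).aestronglyMeasurable
      (hone.mono fun ω hω => Real.log_nonneg hω)).1 h.ne
  have hslln := strong_law_ae_real (fun k ω => Real.log (A k ω)) hint
    (fun i j hij => (hindep.indepFun hij).comp Real.measurable_log Real.measurable_log)
    (fun k => (hident k).comp Real.measurable_log)
  filter_upwards [hslln] with ω hω
  have h1 := hω.comp (tendsto_add_atTop_nat 1)
  have h2 : Tendsto (fun n : ℕ => ((n : ℝ) + 1) / n) atTop (𝓝 1) := by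
    have h3 : Tendsto (fun n : ℕ => 1 + (n : ℝ)⁻¹) atTop (𝓝 1) := by
      simpa using tendsto_inv_atTop_nhds_zero_nat.const_add (1 : ℝ)
    refine h3.congr' ((eventually_gt_atTop 0).mono fun n hn => ?_)
    have hn' : (n : ℝ) ≠ 0 := by exact_mod_cast hn.ne'
    field_simp
  have h3 := (h1.mul h2).sub hω
  rw [mul_one, sub_self] at h3
  -- The `n`-th summand over `n` is the difference of two consecutive averages, the later one
  -- rescaled by `(n + 1) / n`; both have the same limit.
  refine h3.congr' ((eventually_gt_atTop 0).mono fun n hn => ?_)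
  have hn' : (n : ℝ) ≠ 0 := by exact_mod_cast hn.ne'
  have hn1 : (n : ℝ) + 1 ≠ 0 := by positivity
  simp only [Function.comp_apply, Finset.sum_range_succ, Nat.cast_add, Nat.cast_one]
  field_simp
  ring

/-- By independence, the first `m` variables all stay below `M` with probability `q ^ m`, where `q =
P (A 0 ≤ M) < 1`. -/
theorem ae_exists_lt_of_not_ae_le {Ω : Type*} [MeasurableSpace Ω] {P : Measure Ω}
    [IsProbabilityMeasure P] {A : ℕ → Ω → ℝ} (hindep : iIndepFun A P)
    (hident : ∀ k, IdentDistrib (A k) (A 0) P P) {M : ℝ} (h : ¬ ∀ᵐ ω ∂P, A 0 ω ≤ M)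
    (hmeas : ∀ k, Measurable (A k)) :
    ∀ᵐ ω ∂P, ∃ n, M < A n ω := by
  have hq : P (A 0 ⁻¹' Set.Iic M) < 1 := by
    refine lt_of_le_of_ne prob_le_one fun h1 => h ?_
    exact (prob_compl_eq_zero_iff (hmeas 0 measurableSet_Iic)).2 h1
  have hpow : ∀ m : ℕ, P {ω | ∀ n, A n ω ≤ M} ≤ P (A 0 ⁻¹' Set.Iic M) ^ m := by
    intro m
    calc P {ω | ∀ n, A n ω ≤ M} ≤ P (⋂ k ∈ Finset.range m, A k ⁻¹' Set.Iic M) :=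
          measure_mono fun ω hω => by simpa using fun k _ => hω k
      _ = ∏ k ∈ Finset.range m, P (A k ⁻¹' Set.Iic M) :=
          hindep.measure_inter_preimage_eq_mul _ fun _ _ => measurableSet_Iic
      _ = _ := by
          rw [Finset.prod_congr rfl fun k _ => (hident k).measure_mem_eq measurableSet_Iic,
            Finset.prod_const, Finset.card_range]
  have h0 : P {ω | ∀ n, A n ω ≤ M} = 0 := le_antisymm
    (ge_of_tendsto' (ENNReal.tendsto_pow_atTop_nhds_zero_of_lt_one hq) hpow) zero_le
  rw [ae_iff]
  simpa using h0

/-- An almost sure bound on `A 0` would make the integral of its logarithm finite. -/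
theorem ae_unbounded_of_lintegral_log_eq_top {Ω : Type*} [MeasurableSpace Ω] {P : Measure Ω}
    [IsProbabilityMeasure P] {A : ℕ → Ω → ℝ} (hmeas : ∀ k, Measurable (A k))
    (hindep : iIndepFun A P) (hident : ∀ k, IdentDistrib (A k) (A 0) P P)
    (hone : ∀ᵐ ω ∂P, 1 ≤ A 0 ω) (h : ∫⁻ ω, ENNReal.ofReal (Real.log (A 0 ω)) ∂P = ∞) :
    ∀ᵐ ω ∂P, ∀ M : ℕ, ∃ n, (M : ℝ) < A n ω := by
  refine ae_all_iff.2 fun M => ae_exists_lt_of_not_ae_le hindep hident (fun hM => ?_) hmeas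
  refine (lt_top_iff_ne_top.1 ?_) h
  calc ∫⁻ ω, ENNReal.ofReal (Real.log (A 0 ω)) ∂P
      ≤ ∫⁻ _, ENNReal.ofReal (Real.log M) ∂P := lintegral_mono_ae (by
        filter_upwards [hone, hM] with ω h1 h2
        exact ENNReal.ofReal_le_ofReal (Real.log_le_log (by linarith) h2))
    _ < ∞ := by simp

/-- The slowly varying tail is not needed: in the second part the indices at which the coefficients
attain their running maximum do. -/
theorem proposition2p3 {Ω : Type*} [MeasurableSpace Ω] (P : Measure Ω) [IsProbabilityMeasure P]
    (A : ℕ → Ω → ℝ) (hmeas : ∀ k, Measurable (A k)) (hindep : iIndepFun A P)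
    (hident : ∀ k, IdentDistrib (A k) (A 0) P P) (hone : ∀ᵐ ω ∂P, 1 ≤ A 0 ω) :
    (∫⁻ ω, ENNReal.ofReal (Real.log (A 0 ω)) ∂P < ∞ →
      ∀ᵐ ω ∂P, Tendsto (fun n => zeroCountingMeasure (shiftedPoly (fun k => A k ω) n)) atTop
        (𝓝 unitCircleMeasure)) ∧
    (∫⁻ ω, ENNReal.ofReal (Real.log (A 0 ω)) ∂P = ∞ → HasSlowlyVaryingTail P (A 0) →
      ∃ N : ℕ → Ω → ℕ, (∀ j, Measurable (N j)) ∧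
        ∀ᵐ ω ∂P, StrictMono (fun j => N j ω) ∧
          Tendsto (fun j => zeroCountingMeasure (shiftedPoly (fun k => A k ω) (N j ω))) atTop
            (𝓝 unitCircleMeasure)) := by
  have hall : ∀ᵐ ω ∂P, ∀ k, 1 ≤ A k ω :=
    ae_all_iff.2 fun k => (hident k).symm.ae_snd measurableSet_Ici hone
  refine ⟨fun hlog => ?_, fun hlog _ => ?_⟩
  · filter_upwards [hall, ae_tendsto_log_div_of_lintegral_lt_top hmeas hindep hident hone hlog]
      with ω h1 h2
    exact tendsto_zeroCountingMeasure_shiftedPoly h1 tendsto_id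
      (tendsto_log_sum_div_of_tendsto_log_div h1 h2)
  · have hR : ∀ n, MeasurableSet {ω | ∀ k ≤ n, A k ω ≤ A n ω} := fun n => by
      have : {ω | ∀ k ≤ n, A k ω ≤ A n ω} = ⋂ k ≤ n, {ω | A k ω ≤ A n ω} := by
        ext ω
        simp
      exact this ▸ MeasurableSet.iInter fun k => MeasurableSet.iInter fun _ =>
        measurableSet_le (hmeas k) (hmeas n)
    obtain ⟨N, hN, hrec⟩ := exists_measurable_strictMono_nat hR
    refine ⟨N, hN, ?_⟩
    filter_upwards [hall, ae_unbounded_of_lintegral_log_eq_top hmeas hindep hident hone hlog]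
      with ω h1 h2
    obtain ⟨hmono, hmax⟩ := hrec ω (exists_gt_forall_le_of_unbounded h2)
    have hlogn : Tendsto (fun n : ℕ => Real.log n / n) atTop (𝓝 0) :=
      Real.isLittleO_log_id_atTop.tendsto_div_nhds_zero.comp tendsto_natCast_atTop_atTop
    refine ⟨hmono, tendsto_zeroCountingMeasure_shiftedPoly h1 hmono.tendsto_atTop
      (squeeze_zero_norm' ?_ (hlogn.comp hmono.tendsto_atTop))⟩
    filter_upwards [eventually_gt_atTop 0] with j hj
    -- The selection guarantees a record only at successor positions `N (i + 1)`; the initial `N 0`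
    -- is discarded.
    obtain ⟨i, rfl⟩ := Nat.exists_eq_succ_of_ne_zero hj.ne'
    have hpos : 0 < N (i + 1) ω := (Nat.zero_le _).trans_lt (hmono i.lt_succ_self)
    rw [norm_div, Real.norm_eq_abs, Real.norm_natCast]
    exact div_le_div_of_nonneg_right (log_sum_div_le_of_forall_le h1 hpos (hmax i))
      (Nat.cast_nonneg _)
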